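/- Let $m\ge 0$ be an integer, let $\alpha,\alpha_1,\dots,\alpha_m$ be real numbers with $0<\alpha<1$ and $0<\alpha_i<\alpha$ for $i=1,\dots,m$, let $b_1,\dots,b_m>0$, and let $\lambda>0$. For $\beta_1,\dots,\beta_n,\beta>0$ let $$E_{(\beta_1,\dots,\beta_n),\beta}(z_1,\dots,z_n)=\sum_{k=0}^\infty\ \sum_{\substack{l_1+\dots+l_n=k\\ l_1,\dots,l_n\ge 0}}\frac{k!}{l_1!\cdots l_n!}\,\frac{\prod_{i=1}^n z_i^{l_i}}{\Gamma\left(\beta+\sum_{i=1}^n\beta_i l_i\right)}$$ be the multinomial Mittag-Leffler function, put $\vec\alpha=(\alpha,\alpha-\alpha_1,\dots,\alpha-\alpha_m)$, and for $t>0$ define $$\bar E(t)=t^{\alpha-1}E_{\vec\alpha,\alpha}\left(-\lambda t^{\alpha},-b_1t^{\alpha-\alpha_1},\dots,-b_mt^{\alpha-\alpha_m}\right).$$ Then the series defining $\bar E(t)$ converges for every $t>0$, and $\bar E$ is completely monotone on $(0,\infty)$, i.e. $\bar E\in C^\infty(0,\infty)$ and $(-1)^n\bar E^{(n)}(t)\ge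 0$ for all integers $n\ge 0$ and all $t>0$. Moreover, for every $T>0$, $\bar E$ is integrable on $(0,T)$ and $$\int_0^T|\bar E(t)|\,dt<\frac1{\lambda}.$$ In particular this holds with $\lambda=\lambda_j$ for each eigenvalue $\lambda_j>0$, $j\in\mathbb N$, of the Dirichlet Laplacian $-\Delta$ on a bounded domain. -/

import Mathlib

open scoped ContDiff

noncomputable section

/-- The part of total degree `k` of the multinomial Mittag-Leffler series,
`∑_{l_1 + ... + l_n = k} (k; l_1, ..., l_n) ∏ z_i ^ l_i / Γ(β₀ + ∑ β_i l_i)`. -/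
def multinomialMLTerm {𝕜 : Type*} [RCLike 𝕜] {n : ℕ} (β : Fin n → ℝ) (β₀ : ℝ) (z : Fin n → 𝕜)
    (k : ℕ) : 𝕜 :=
  ∑ l ∈ Finset.piAntidiag (Finset.univ : Finset (Fin n)) k,
    (Nat.multinomial Finset.univ l : 𝕜) *
      ((∏ i, z i ^ l i) / ((Real.Gamma (β₀ + ∑ i, β i * (l i : ℝ)) : ℝ) : 𝕜))

/-- The multinomial Mittag-Leffler function `E_{(β_1, ..., β_n), β₀}(z_1, ..., z_n)`, for real
or complex arguments. -/
def multinomialML {𝕜 : Type*} [RCLike 𝕜] {n : ℕ} (β : Fin n → ℝ) (β₀ : ℝ) (z : Fin n → 𝕜) : 𝕜 :=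
  ∑' k : ℕ, multinomialMLTerm β β₀ z k

/-- The exponents `(α, α - α_1, ..., α - α_m)`. -/
def kernelOrders {m : ℕ} (α : ℝ) (a : Fin m → ℝ) : Fin (m + 1) → ℝ :=
  Matrix.vecCons α fun i => α - a i

/-- The arguments `(-λ t^α, -b_1 t^(α - α_1), ..., -b_m t^(α - α_m))`. -/
def kernelArgs {m : ℕ} (α : ℝ) (a b : Fin m → ℝ) (lam t : ℝ) : Fin (m + 1) → ℝ :=
  Matrix.vecCons (-lam * t ^ α) fun i => -b i * t ^ (α - a i)

/-- The scalar kernel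
`t^(α-1) E_{(α, α-α_1, ..., α-α_m), α}(-λ t^α, -b_1 t^(α-α_1), ..., -b_m t^(α-α_m))`. -/
def scalarKernel {m : ℕ} (α : ℝ) (a b : Fin m → ℝ) (lam t : ℝ) : ℝ :=
  t ^ (α - 1) * multinomialML (kernelOrders α a) α (kernelArgs α a b lam t)

/-- Complete monotonicity on `(0, ∞)`: `f` is smooth there and `(-1)^n f^(n) ≥ 0` for all `n`. -/
def IsCompletelyMonotone (f : ℝ → ℝ) : Prop :=
  ContDiffOn ℝ ∞ f (Set.Ioi 0) ∧
    ∀ (n : ℕ) (t : ℝ), 0 < t → 0 ≤ (-1) ^ n * iteratedDerivWithin n f (Set.Ioi 0) t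

end

/-!
For large `s` the Laplace transform of the kernel can be computed term by term and equals `1 / P`,
where `P(s) = s ^ α + λ + ∑ b_i s ^ α_i`. On the plane slit along the negative axis `P` is analytic
and `Im P > 0` in the upper half plane up to the cut, because all exponents lie in `(0, 1)`. Hence
`1 / P` is analytic on the slit plane, and Cauchy's formula exhibits it as the Stieltjes transform
of a positive measure `μ` on the cut. The Stieltjes transform is the Laplace transform of
`t ↦ ∫ e ^ (-t r) dμ(r)`, so by Lerch's uniqueness theorem this function is the kernel, which is
therefore positive and completely monotone. Letting `s → 0` in `1 / P(s) < 1 / λ` bounds its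
integral.

The slit plane is uniformised by `w = log z`, which turns it into a strip and the power functions
into exponentials.
-/

open MeasureTheory ProbabilityTheory Filter Topology Set

section Laplace

/-- The Laplace transform `∫ e^{-st} f(t) dt` over `(0, ∞)` converges absolutely at `s`, with
value `L`. The values of `f` outside `(0, ∞)` are irrelevant. -/
def HasLaplace (f : ℝ → ℝ) (s L : ℝ) : Prop :=
  IntegrableOn (fun t => Real.exp (-(s * t)) * f t) (Ioi 0) ∧
    ∫ t in Ioi (0 : ℝ), Real.exp (-(s * t)) * f t = L

variable {f g : ℝ → ℝ} {s L M : ℝ}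

theorem HasLaplace.congr (hf : HasLaplace f s L) (h : EqOn f g (Ioi 0)) : HasLaplace g s L := by
  have h' : EqOn (fun t => Real.exp (-(s * t)) * f t) (fun t => Real.exp (-(s * t)) * g t)
      (Ioi 0) := fun t ht => congrArg (Real.exp (-(s * t)) * ·) (h ht)
  exact ⟨hf.1.congr_fun h' measurableSet_Ioi,
    (setIntegral_congr_fun measurableSet_Ioi h').symm.trans hf.2⟩

theorem HasLaplace.sub (hf : HasLaplace f s L) (hg : HasLaplace g s M) :
    HasLaplace (fun t => f t - g t) s (L - M) := by
  simp only [HasLaplace, mul_sub]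
  exact ⟨hf.1.sub hg.1, by rw [integral_sub hf.1 hg.1, hf.2, hg.2]⟩

theorem HasLaplace.const_mul (c : ℝ) (hf : HasLaplace f s L) :
    HasLaplace (fun t => c * f t) s (c * L) := by
  simp only [HasLaplace, mul_left_comm _ c]
  exact ⟨hf.1.const_mul c, by rw [integral_const_mul, hf.2]⟩

theorem HasLaplace.sum {ι : Type*} {S : Finset ι} {F : ι → ℝ → ℝ} {L : ι → ℝ}
    (hF : ∀ i ∈ S, HasLaplace (F i) s (L i)) :
    HasLaplace (fun t => ∑ i ∈ S, F i t) s (∑ i ∈ S, L i) := by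
  simp only [HasLaplace, Finset.mul_sum]
  exact ⟨integrable_finsetSum S fun i hi => (hF i hi).1, by
    rw [integral_finsetSum S fun i hi => (hF i hi).1, Finset.sum_congr rfl fun i hi => (hF i hi).2]⟩

theorem integrable_of_hasSum_of_summable_integral_norm {Ω : Type*} [MeasurableSpace Ω]
    {μ : Measure Ω} {F : ℕ → Ω → ℝ} {f : Ω → ℝ} (hF : ∀ k, Integrable (F k) μ)
    (hsum : Summable fun k => ∫ x, ‖F k x‖ ∂μ) (hf : ∀ᵐ x ∂μ, HasSum (fun k => F k x) (f x)) :
    Integrable f μ := by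
  have hmeas : AEStronglyMeasurable f μ :=
    aestronglyMeasurable_of_tendsto_ae atTop
      (fun n => Finset.aestronglyMeasurable_fun_sum (Finset.range n) fun k _ => (hF k).1)
      (hf.mono fun x hx => hx.tendsto_sum_nat)
  refine ⟨hmeas, ?_⟩
  calc ∫⁻ x, ‖f x‖ₑ ∂μ ≤ ∫⁻ x, ∑' k, ‖F k x‖ₑ ∂μ :=
        lintegral_mono_ae (hf.mono fun x hx => hx.tsum_eq ▸ enorm_tsum_le_tsum_enorm)
    _ = ∑' k, ∫⁻ x, ‖F k x‖ₑ ∂μ := lintegral_tsum fun k => (hF k).1.enorm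
    _ = ∑' k, ENNReal.ofReal (∫ x, ‖F k x‖ ∂μ) :=
        tsum_congr fun k => (ofReal_integral_norm_eq_lintegral_enorm (hF k)).symm
    _ < ⊤ := hsum.tsum_ofReal_lt_top

theorem HasLaplace.hasSum_of_norm_le {F G : ℕ → ℝ → ℝ} {L M : ℕ → ℝ}
    (hF : ∀ k, HasLaplace (F k) s (L k)) (hG : ∀ k, HasLaplace (G k) s (M k))
    (hFG : ∀ k t, 0 < t → ‖F k t‖ ≤ G k t) (hM : Summable M)
    (hf : ∀ t, 0 < t → HasSum (fun k => F k t) (f t)) : HasLaplace f s (∑' k, L k) := by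
  have hsum : Summable fun k => ∫ t in Ioi (0 : ℝ), ‖Real.exp (-(s * t)) * F k t‖ := by
    refine hM.of_nonneg_of_le (fun k => integral_nonneg fun t => norm_nonneg _) fun k => ?_
    rw [← (hG k).2]
    refine setIntegral_mono_on (hF k).1.norm (hG k).1 measurableSet_Ioi fun t ht => ?_
    rw [norm_mul, Real.norm_of_nonneg (Real.exp_pos _).le]
    gcongr
    exact hFG k t ht
  have hf' : ∀ᵐ t ∂volume.restrict (Ioi (0 : ℝ)),
      HasSum (fun k => Real.exp (-(s * t)) * F k t) (Real.exp (-(s * t)) * f t) := by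
    filter_upwards [ae_restrict_mem measurableSet_Ioi] with t ht using (hf t ht).mul_left _
  refine ⟨integrable_of_hasSum_of_summable_integral_norm (fun k => (hF k).1) hsum hf', ?_⟩
  rw [← integral_congr_ae (hf'.mono fun t ht => ht.tsum_eq),
    ← integral_tsum_of_summable_integral_norm (fun k => (hF k).1) hsum]
  exact tsum_congr fun k => (hF k).2

theorem hasLaplace_rpow_sub_one {r : ℝ} (hr : 0 < r) (hs : 0 < s) :
    HasLaplace (fun t => t ^ (r - 1)) s (Real.Gamma r * s ^ (-r)) := by
  have hval : ∫ t in Ioi (0 : ℝ), Real.exp (-(s * t)) * t ^ (r - 1) = Real.Gamma r * s ^ (-r) := by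
    simp only [mul_comm (Real.exp _)]
    rw [Real.integral_rpow_mul_exp_neg_mul_Ioi hr hs, one_div, Real.inv_rpow hs.le,
      Real.rpow_neg hs.le, mul_comm]
  refine ⟨Integrable.of_integral_ne_zero ?_, hval⟩
  rw [hval]
  have := Real.Gamma_pos_of_pos hr
  positivity

theorem integral_polynomial_exp_neg_mul_eq_zero
    (h : ∀ n : ℕ, HasLaplace f n 0) (p : Polynomial ℝ) :
    IntegrableOn (fun t => p.eval (Real.exp (-t)) * f t) (Ioi 0) ∧
      ∫ t in Ioi (0 : ℝ), p.eval (Real.exp (-t)) * f t = 0 := by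
  have hpow (n : ℕ) (t : ℝ) : Real.exp (-t) ^ n = Real.exp (-(n * t)) := by
    rw [← Real.exp_nat_mul, mul_neg]
  have hsum : HasLaplace (fun t => p.eval (Real.exp (-t)) * f t) 0 0 := by
    have := HasLaplace.sum (S := p.support) (s := 0)
      (F := fun n t => p.coeff n * (Real.exp (-t) ^ n * f t)) (L := fun n => p.coeff n * 0)
      fun n _ => HasLaplace.const_mul (p.coeff n) (by
        simpa only [HasLaplace, hpow, zero_mul, neg_zero, Real.exp_zero, one_mul] using h n)
    simpa only [Polynomial.eval_eq_sum, Polynomial.sum, Finset.sum_mul, mul_assoc, mul_zero,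
      Finset.sum_const_zero] using this
  simpa only [HasLaplace, zero_mul, neg_zero, Real.exp_zero, one_mul] using hsum

theorem integral_comp_exp_neg_mul_eq_zero
    (h : ∀ n : ℕ, HasLaplace f n 0) {φ : ℝ → ℝ} (hφ : Continuous φ) :
    ∫ t in Ioi (0 : ℝ), φ (Real.exp (-t)) * f t = 0 := by
  have hf : IntegrableOn f (Ioi 0) := by simpa [HasLaplace] using (h 0).1
  have hbound (ε : ℝ) (hε : 0 < ε) :
      ‖∫ t in Ioi (0 : ℝ), φ (Real.exp (-t)) * f t‖ ≤ ε * ∫ t in Ioi (0 : ℝ), ‖f t‖ := by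
    obtain ⟨p, hp⟩ := exists_polynomial_near_of_continuousOn 0 1 φ hφ.continuousOn ε hε
    obtain ⟨hpi, hp0⟩ := integral_polynomial_exp_neg_mul_eq_zero h p
    have hclose (t : ℝ) (ht : 0 < t) :
        ‖(φ (Real.exp (-t)) - p.eval (Real.exp (-t))) * f t‖ ≤ ε * ‖f t‖ := by
      rw [norm_mul]
      gcongr
      rw [norm_sub_rev]
      exact (hp _ ⟨(Real.exp_pos _).le, Real.exp_le_one_iff.2 (by linarith)⟩).le
    have hdiff : IntegrableOn (fun t => (φ (Real.exp (-t)) - p.eval (Real.exp (-t))) * f t)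
        (Ioi 0) := by
      refine (hf.norm.const_mul ε).mono' (.mul (by fun_prop) hf.1) ?_
      filter_upwards [ae_restrict_mem measurableSet_Ioi] with t ht using hclose t ht
    calc ‖∫ t in Ioi (0 : ℝ), φ (Real.exp (-t)) * f t‖
        = ‖∫ t in Ioi (0 : ℝ), (φ (Real.exp (-t)) - p.eval (Real.exp (-t))) * f t‖ := by
          have hadd := integral_add hdiff hpi
          simp only [hp0, add_zero, sub_mul, sub_add_cancel] at hadd
          simp only [hadd, sub_mul]
      _ ≤ ∫ t in Ioi (0 : ℝ), ε * ‖f t‖ := by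
          refine norm_integral_le_of_norm_le (hf.norm.const_mul ε) ?_
          filter_upwards [ae_restrict_mem measurableSet_Ioi] with t ht using hclose t ht
      _ = ε * ∫ t in Ioi (0 : ℝ), ‖f t‖ := integral_const_mul _ _
  have hlim : Tendsto (fun ε => ε * ∫ t in Ioi (0 : ℝ), ‖f t‖) (𝓝[>] 0) (𝓝 0) := by
    have : Continuous fun ε : ℝ => ε * ∫ t in Ioi (0 : ℝ), ‖f t‖ := by fun_prop
    simpa using (this.tendsto 0).mono_left nhdsWithin_le_nhds
  exact norm_le_zero_iff.1 (ge_of_tendsto hlim (eventually_mem_nhdsWithin.mono hbound))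

theorem continuous_comp_neg_log {ψ : ℝ → ℝ} (hψ : Continuous ψ) (hψc : HasCompactSupport ψ)
    (hψ0 : ψ 0 = 0) : Continuous fun x => ψ (-Real.log x) := by
  refine continuous_iff_continuousAt.2 fun x => ?_
  rcases eq_or_ne x 0 with rfl | hx
  · rw [continuousAt_iff_punctured_nhds]
    have hatTop : Tendsto (fun x => -Real.log x) (𝓝[≠] 0) (cocompact ℝ) :=
      (tendsto_neg_atBot_atTop.comp Real.tendsto_log_nhdsNE_zero).mono_right atTop_le_cocompact
    simpa [hψ0, Function.comp_def] using hψc.is_zero_at_infty.comp hatTop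
  · exact hψ.continuousAt.comp (Real.continuousAt_log hx).neg

/-- Lerch's theorem: the moments of `f` in the variable `x = e^{-t}` determine integrals against
all continuous functions of `x ∈ [0, 1]`, by Weierstrass approximation. -/
theorem ae_eq_zero_of_hasLaplace_nat (h : ∀ n : ℕ, HasLaplace f n 0) :
    ∀ᵐ t, t ∈ Ioi (0 : ℝ) → f t = 0 := by
  have hf : IntegrableOn f (Ioi 0) := by simpa [HasLaplace] using (h 0).1
  refine isOpen_Ioi.ae_eq_zero_of_integral_contDiff_smul_eq_zero hf.locallyIntegrableOn
    fun ψ hψ hψc hψs => ?_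
  have hψ0 (t : ℝ) (ht : t ∉ Ioi (0 : ℝ)) : ψ t = 0 :=
    image_eq_zero_of_notMem_tsupport fun h => ht (hψs h)
  rw [← setIntegral_eq_integral_of_forall_compl_eq_zero (s := Ioi 0) fun t ht => by
    simp [hψ0 t ht]]
  simpa using integral_comp_exp_neg_mul_eq_zero h
    (continuous_comp_neg_log hψ.continuous hψc (hψ0 0 self_notMem_Ioi))

theorem HasLaplace.eqOn_of_eventually {L : ℝ → ℝ} (hf : ContinuousOn f (Ioi 0))
    (hg : ContinuousOn g (Ioi 0)) (hfL : ∀ᶠ s in atTop, HasLaplace f s (L s))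
    (hgL : ∀ᶠ s in atTop, HasLaplace g s (L s)) : EqOn f g (Ioi 0) := by
  obtain ⟨s₀, hs₀⟩ := eventually_atTop.1 (hfL.and hgL)
  have hdiff (n : ℕ) : HasLaplace (fun t => Real.exp (-(s₀ * t)) * (f t - g t)) n 0 := by
    obtain ⟨hfn, hgn⟩ := hs₀ (n + s₀) (by simp)
    simpa only [HasLaplace, ← mul_assoc, ← Real.exp_add, ← neg_add, ← add_mul, sub_self]
      using hfn.sub hgn
  refine Measure.eqOn_open_of_ae_eq (μ := volume)
    ((ae_restrict_iff' measurableSet_Ioi).2 ?_) isOpen_Ioi hf hg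
  filter_upwards [ae_eq_zero_of_hasLaplace_nat hdiff] with t ht ht0
  simpa [sub_eq_zero, (Real.exp_pos _).ne'] using ht ht0

theorem HasLaplace.integrableOn_Ioc (hf : HasLaplace f s L) (R : ℝ) : IntegrableOn f (Ioc 0 R) := by
  have hexp := (hf.1.mono_set (Ioc_subset_Ioi_self : Ioc 0 R ⊆ Ioi 0)).continuousOn_mul_of_subset
    (g := fun t => Real.exp (s * t)) (by fun_prop) isCompact_Icc measurableSet_Ioc
    Ioc_subset_Icc_self
  refine hexp.congr_fun (fun t _ => ?_) measurableSet_Ioc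
  simp only [← mul_assoc, ← Real.exp_add, add_neg_cancel, Real.exp_zero, one_mul]

theorem HasLaplace.intervalIntegrable (hf : HasLaplace f s L) {A R : ℝ} (hA : 0 ≤ A)
    (hR : 0 ≤ R) : IntervalIntegrable f volume A R := by
  have h0 {R : ℝ} (hR : 0 ≤ R) : IntervalIntegrable f volume 0 R :=
    (intervalIntegrable_iff_integrableOn_Ioc_of_le hR).2 (hf.integrableOn_Ioc R)
  exact (h0 hA).symm.trans (h0 hR)

theorem HasLaplace.exp_mul_setIntegral_Ioc_le (hf : HasLaplace f s L) (hs : 0 ≤ s)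
    (hnonneg : ∀ t, 0 < t → 0 ≤ f t) (R : ℝ) :
    Real.exp (-(s * R)) * ∫ t in Ioc 0 R, f t ≤ L := by
  rw [← integral_const_mul, ← hf.2]
  calc ∫ t in Ioc 0 R, Real.exp (-(s * R)) * f t
      ≤ ∫ t in Ioc 0 R, Real.exp (-(s * t)) * f t := by
        refine setIntegral_mono_on ((hf.integrableOn_Ioc R).const_mul _)
          (hf.1.mono_set Ioc_subset_Ioi_self) measurableSet_Ioc fun t ht => ?_
        have := hnonneg t ht.1
        have := ht.2
        gcongr
    _ ≤ ∫ t in Ioi 0, Real.exp (-(s * t)) * f t := by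
        refine setIntegral_mono_set hf.1 ?_ Ioc_subset_Ioi_self.eventuallyLE
        filter_upwards [ae_restrict_mem measurableSet_Ioi] with t ht
        exact mul_nonneg (Real.exp_pos _).le (hnonneg t ht)

theorem integral_le_of_hasLaplace_le {L : ℝ → ℝ} (hf : ∀ s, 0 < s → HasLaplace f s (L s))
    (hL : ∀ s, 0 < s → L s ≤ M) (hnonneg : ∀ t, 0 < t → 0 ≤ f t) {R : ℝ} (hR : 0 ≤ R) :
    ∫ t in (0 : ℝ)..R, f t ≤ M := by
  rw [intervalIntegral.integral_of_le hR]
  have hlim : Tendsto (fun s : ℝ => Real.exp (-(s * R)) * ∫ t in Ioc 0 R, f t) (𝓝[>] 0)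
      (𝓝 (∫ t in Ioc 0 R, f t)) := by
    have : Continuous fun s : ℝ => Real.exp (-(s * R)) * ∫ t in Ioc 0 R, f t := by fun_prop
    simpa using (this.tendsto 0).mono_left nhdsWithin_le_nhds
  refine le_of_tendsto hlim (eventually_mem_nhdsWithin.mono fun s hs => ?_)
  exact ((hf s hs).exp_mul_setIntegral_Ioc_le (le_of_lt hs) hnonneg R).trans (hL s hs)

theorem integral_lt_of_hasLaplace_le {L : ℝ → ℝ} (hf : ∀ s, 0 < s → HasLaplace f s (L s))
    (hL : ∀ s, 0 < s → L s ≤ M) (hpos : ∀ t, 0 < t → 0 < f t) {T : ℝ} (hT : 0 ≤ T) :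
    ∫ t in (0 : ℝ)..T, f t < M := by
  have hT1 : 0 ≤ T + 1 := by linarith
  have hint {A R : ℝ} (hA : 0 ≤ A) (hR : 0 ≤ R) := (hf 1 one_pos).intervalIntegrable hA hR
  calc ∫ t in (0 : ℝ)..T, f t < (∫ t in (0 : ℝ)..T, f t) + ∫ t in T..(T + 1), f t :=
        lt_add_of_pos_right _ (intervalIntegral.intervalIntegral_pos_of_pos_on (hint hT hT1)
          (fun t ht => hpos t (hT.trans_lt ht.1)) (by linarith))
    _ = ∫ t in (0 : ℝ)..(T + 1), f t :=
        intervalIntegral.integral_add_adjacent_intervals (hint le_rfl hT) (hint hT hT1)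
    _ ≤ M := integral_le_of_hasLaplace_le hf hL (fun t ht => (hpos t ht).le) hT1

end Laplace

section MomentGeneratingFunction

theorem IsCompletelyMonotone.congr {f g : ℝ → ℝ} (hf : IsCompletelyMonotone f)
    (h : EqOn f g (Ioi 0)) : IsCompletelyMonotone g :=
  ⟨hf.1.congr h.symm, fun n t ht => iteratedDerivWithin_congr h ht ▸ hf.2 n t ht⟩

variable {Ω : Type*} [MeasurableSpace Ω] {μ : Measure Ω} {X : Ω → ℝ} {s : ℝ}

theorem integrable_exp_mul_of_integrable_inv_sub (hX : AEMeasurable X μ) (hX0 : ∀ x, X x ≤ 0)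
    (hs : 0 < s) (hint : Integrable (fun x => (s - X x)⁻¹) μ) {t : ℝ} (ht : 0 < t) :
    Integrable (fun x => Real.exp (t * X x)) μ := by
  refine (hint.const_mul (s + 1 / t)).mono' (by fun_prop) (ae_of_all _ fun x => ?_)
  have hle_one : Real.exp (t * X x) ≤ 1 :=
    Real.exp_le_one_iff.2 (mul_nonpos_of_nonneg_of_nonpos ht.le (hX0 x))
  have hmul_le_one : -(t * X x) * Real.exp (t * X x) ≤ 1 := by
    rw [← le_div_iff₀ (Real.exp_pos _), one_div, ← Real.exp_neg]
    linarith [Real.add_one_le_exp (-(t * X x))]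
  rw [Real.norm_of_nonneg (Real.exp_pos _).le, ← div_eq_mul_inv,
    le_div_iff₀ (by linarith [hX0 x])]
  calc Real.exp (t * X x) * (s - X x)
      = s * Real.exp (t * X x) + 1 / t * (-(t * X x) * Real.exp (t * X x)) := by
        field_simp
        ring
    _ ≤ s * 1 + 1 / t * 1 := by gcongr
    _ = s + 1 / t := by ring

theorem Ioi_subset_interior_integrableExpSet (hX : AEMeasurable X μ) (hX0 : ∀ x, X x ≤ 0)
    (hs : 0 < s) (hint : Integrable (fun x => (s - X x)⁻¹) μ) :
    Ioi (0 : ℝ) ⊆ interior (integrableExpSet X μ) :=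
  interior_maximal (fun _ => integrable_exp_mul_of_integrable_inv_sub hX hX0 hs hint) isOpen_Ioi

theorem isCompletelyMonotone_mgf (hX0 : ∀ x, X x ≤ 0)
    (hexp : Ioi (0 : ℝ) ⊆ interior (integrableExpSet X μ)) : IsCompletelyMonotone (mgf X μ) := by
  refine ⟨(analyticOnNhd_mgf.mono hexp).contDiffOn (uniqueDiffOn_Ioi 0), fun n t ht => ?_⟩
  rw [iteratedDerivWithin_of_isOpen isOpen_Ioi ht, iteratedDeriv_mgf (hexp ht),
    ← integral_const_mul]
  refine integral_nonneg fun x => ?_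
  have hsign : 0 ≤ (-1) ^ n * X x ^ n := neg_pow (X x) n ▸ pow_nonneg (neg_nonneg.2 (hX0 x)) n
  exact mul_assoc ((-1 : ℝ) ^ n) _ _ ▸ mul_nonneg hsign (Real.exp_pos _).le

theorem hasLaplace_mgf [SFinite μ] (hX : AEMeasurable X μ) (hX0 : ∀ x, X x ≤ 0) (hs : 0 < s)
    (hint : Integrable (fun x => (s - X x)⁻¹) μ) :
    HasLaplace (mgf X μ) s (∫ x, (s - X x)⁻¹ ∂μ) := by
  have hneg (x : Ω) : -(s - X x) < 0 := by linarith [hX0 x]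
  have hexp (t : ℝ) (x : Ω) :
      Real.exp (-(s * t)) * Real.exp (t * X x) = Real.exp (-(s - X x) * t) := by
    rw [← Real.exp_add]
    ring_nf
  have hinner (x : Ω) : ∫ t in Ioi (0 : ℝ), Real.exp (-(s - X x) * t) = (s - X x)⁻¹ := by
    rw [integral_exp_mul_Ioi (hneg x), mul_zero, Real.exp_zero, neg_div_neg_eq, one_div]
  have hprod : Integrable (fun p : ℝ × Ω => Real.exp (-(s * p.1)) * Real.exp (p.1 * X p.2))
      ((volume.restrict (Ioi 0)).prod μ) := by
    have hmeas : AEMeasurable (fun p : ℝ × Ω => p.1 * X p.2) ((volume.restrict (Ioi 0)).prod μ) :=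
      measurable_fst.aemeasurable.mul hX.comp_snd
    have := hmeas.exp.aestronglyMeasurable
    rw [integrable_prod_iff' (by fun_prop)]
    simp only [hexp, Real.norm_of_nonneg (Real.exp_pos _).le, hinner]
    exact ⟨ae_of_all _ fun x => integrableOn_exp_mul_Ioi (hneg x) 0, hint⟩
  simp only [HasLaplace, mgf, ← integral_const_mul]
  exact ⟨hprod.integral_prod_left, by rw [integral_integral_swap hprod]; simp only [hexp, hinner]⟩

end MomentGeneratingFunction

section Stieltjes

open Complex
open scoped ComplexConjugate Real

/-- The closed strip `|Im w| ≤ π`, the image under the logarithm of the slit plane with both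
sides of the slit. -/
def logStrip : Set ℂ := {w | |w.im| ≤ π}

theorem add_mul_I_mem_logStrip {x y : ℝ} (hy : |y| ≤ π) : (x + y * I : ℂ) ∈ logStrip := by
  simpa [logStrip] using hy

theorem logStrip_mem_nhds_ofReal (x : ℝ) : logStrip ∈ 𝓝 (x : ℂ) := by
  have hopen : {w : ℂ | |w.im| < π} ∈ 𝓝 (x : ℂ) :=
    (isOpen_lt (by fun_prop) (by fun_prop)).mem_nhds (by simpa using Real.pi_pos)
  exact mem_of_superset hopen fun w (hw : |w.im| < π) => hw.le

theorem eq_of_exp_eq_of_mem_logStrip {w : ℂ} {u : ℝ} (hw : w ∈ logStrip)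
    (h : exp w = exp u) : w = u := by
  obtain ⟨n, hn⟩ := exp_eq_exp_iff_exists_int.1 h
  have him : w.im = n * (2 * π) := by simpa using congrArg im hn
  have hn1 : |(n : ℝ)| < 1 := by
    have hw' : |w.im| ≤ π := hw
    rw [him, abs_mul, abs_of_pos Real.two_pi_pos] at hw'
    nlinarith [Real.pi_pos]
  have hn0 : n = 0 := Int.abs_lt_one_iff.1 (mod_cast hn1)
  simpa [hn0] using hn

variable {h : ℂ → ℂ}

/-- The difference quotient of `h` with respect to `exp`, times `exp`: in the coordinate
`z = exp w` this is `(h z - h z₀) / (z - z₀) dz`, whose singularity at `z₀ = exp u` is removed. -/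
noncomputable def expSlope (h : ℂ → ℂ) (u w : ℂ) : ℂ :=
  dslope h u w / dslope exp u w * exp w

theorem expSlope_of_ne {u w : ℂ} (hne : w ≠ u) :
    expSlope h u w = (h w - h u) / (exp w - exp u) * exp w := by
  rw [expSlope, dslope_of_ne _ hne, dslope_of_ne _ hne, slope_def_field, slope_def_field,
    div_div_div_cancel_right₀ (sub_ne_zero.2 hne)]

theorem expSlope_of_exp_eq_neg {w : ℂ} {u x : ℝ} (hw : exp w = -exp x) :
    expSlope h u w = (h w - h u) * (Real.exp x / (Real.exp x + Real.exp u) : ℝ) := by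
  have hpos : Real.exp x + Real.exp u ≠ 0 := by positivity
  have hadd : exp (x : ℂ) + exp u ≠ 0 := by exact_mod_cast hpos
  have hsub : -exp (x : ℂ) - exp u ≠ 0 := neg_add' (exp (x : ℂ)) _ ▸ neg_ne_zero.2 hadd
  rw [expSlope_of_ne (by rintro rfl; exact hsub (by rw [hw, sub_self])), hw]
  push_cast
  field_simp
  ring

theorem differentiableOn_expSlope (hh : DifferentiableOn ℂ h logStrip) (u : ℝ) :
    DifferentiableOn ℂ (expSlope h u) logStrip := by
  have hu := logStrip_mem_nhds_ofReal u
  refine (((differentiableOn_dslope hu).2 hh).div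
    ((differentiableOn_dslope hu).2 differentiable_exp.differentiableOn) fun w hw => ?_).mul
    differentiable_exp.differentiableOn
  rcases eq_or_ne w u with rfl | hne
  · rw [dslope_same, Complex.deriv_exp]
    exact exp_ne_zero _
  · rw [dslope_of_ne _ hne, slope_def_field]
    exact div_ne_zero (sub_ne_zero.2 fun h => hne (eq_of_exp_eq_of_mem_logStrip hw h))
      (sub_ne_zero.2 hne)

theorem tendsto_expSlope_comap_re_atTop {l : Filter ℂ} (hl : l ≤ comap re atTop)
    (hh : Tendsto h l (𝓝 0)) (u : ℝ) : Tendsto (expSlope h u) l (𝓝 (-h u)) := by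
  have hexp : Tendsto exp l (Bornology.cobounded ℂ) := tendsto_exp_comap_re_atTop.mono_left hl
  have hquot : Tendsto (fun w => (1 - exp u * (exp w)⁻¹)⁻¹) l (𝓝 1) := by
    simpa using ((tendsto_inv₀_cobounded.comp hexp).const_mul (exp u)).const_sub 1 |>.inv₀
  have hne : ∀ᶠ w : ℂ in l, w ≠ u :=
    ((tendsto_comap.mono_left hl).eventually_gt_atTop u).mono fun w hw hwu => by simp [hwu] at hw
  have hlim : Tendsto (fun w => (h w - h u) * (1 - exp u * (exp w)⁻¹)⁻¹) l (𝓝 (-h u)) := by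
    simpa using (hh.sub_const (h u)).mul hquot
  refine hlim.congr' (hne.mono fun w hw => ?_)
  rw [expSlope_of_ne hw, div_mul_eq_mul_div, mul_div_assoc, ← inv_div, sub_div,
    div_self (exp_ne_zero w), div_eq_mul_inv]

theorem tendsto_expSlope_comap_re_atBot {l : Filter ℂ} (hl : l ≤ comap re atBot)
    (hh : Tendsto (fun w => h w * exp w) l (𝓝 0)) (u : ℝ) :
    Tendsto (expSlope h u) l (𝓝 0) := by
  have hexp : Tendsto exp l (𝓝 0) :=
    tendsto_exp_comap_re_atBot.mono_left hl
  have hne : ∀ᶠ w : ℂ in l, w ≠ u :=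
    ((tendsto_comap.mono_left hl).eventually_lt_atBot u).mono fun w hw hwu => by simp [hwu] at hw
  have hlim : Tendsto (fun w => (h w * exp w - h u * exp w) / (exp w - exp u)) l (𝓝 0) := by
    simpa [Pi.div_def] using (hh.sub (hexp.const_mul (h u))).div (hexp.sub_const (exp u)) (by simp)
  refine hlim.congr' (hne.mono fun w hw => ?_)
  rw [expSlope_of_ne hw, div_mul_eq_mul_div, sub_mul]

theorem tendsto_integral_vertical_segment {F : ℂ → ℂ} {L : ℂ} (hF : ContinuousOn F logStrip)
    {l : Filter ℝ} [l.IsCountablyGenerated] (hlim : Tendsto F (comap re l ⊓ 𝓟 logStrip) (𝓝 L)) :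
    Tendsto (fun N : ℝ => ∫ y in (-π)..π, F (N + y * I)) l (𝓝 (2 * π * L)) := by
  have hmem {y : ℝ} (hy : y ∈ uIoc (-π) π) : |y| ≤ π := by
    rw [uIoc_of_le (by linarith [Real.pi_pos])] at hy
    exact abs_le.2 ⟨hy.1.le, hy.2⟩
  have huniform {p : ℂ → Prop} (hp : ∀ᶠ w in comap re l ⊓ 𝓟 logStrip, p w) :
      ∀ᶠ N : ℝ in l, ∀ y : ℝ, y ∈ uIoc (-π) π → p (N + y * I) := by
    rw [eventually_inf_principal, eventually_comap] at hp
    exact hp.mono fun N hN y hy => hN _ (by simp) (add_mul_I_mem_logStrip (hmem hy))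
  have hbound : ∀ᶠ w in comap re l ⊓ 𝓟 logStrip, ‖F w‖ ≤ ‖L‖ + 1 :=
    hlim.norm.eventually_le_const (lt_add_one _)
  have hL : ∫ _ in (-π)..π, L = 2 * π * L := by
    rw [intervalIntegral.integral_const, real_smul]
    push_cast
    ring
  rw [← hL]
  refine intervalIntegral.tendsto_integral_filter_of_dominated_convergence (fun _ => ‖L‖ + 1)
    (.of_forall fun N => ?_) ((huniform hbound).mono fun N hN => ae_of_all _ hN) (by simp)
    (ae_of_all _ fun y hy => ?_)
  · exact (hF.comp (by fun_prop) fun y hy => add_mul_I_mem_logStrip (hmem hy)).aestronglyMeasurable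
      measurableSet_uIoc
  · rw [tendsto_iff_eventually]
    exact fun p hp => (huniform (hlim.eventually hp)).mono fun N hN => hN y hy

/-- The jump of `h` across the slit, normalised to be the density in Stieltjes' inversion
formula. -/
noncomputable def stieltjesDensity (h : ℂ → ℂ) (x : ℝ) : ℝ := -(h (x + π * I)).im / π

theorem continuous_stieltjesDensity (hh : ContinuousOn h logStrip) :
    Continuous (stieltjesDensity h) := by
  have htop : Continuous fun x : ℝ => h (x + π * I) :=
    hh.comp_continuous (by fun_prop) fun x => add_mul_I_mem_logStrip (abs_of_pos Real.pi_pos).le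
  exact ((continuous_im.comp htop).neg).div_const π

theorem expSlope_bottom_sub_top (hconj : ∀ w, h (conj w) = conj (h w)) (u x : ℝ) :
    expSlope h u (x + (-π : ℝ) * I) - expSlope h u (x + π * I) =
      2 * π * I * ((stieltjesDensity h x * (Real.exp x / (Real.exp x + Real.exp u)) : ℝ) : ℂ) := by
  have htop : exp (x + π * I) = -exp x := by rw [exp_add, exp_pi_mul_I, mul_neg_one]
  have hbottom : exp (x + (-π : ℝ) * I) = -exp x := by
    rw [exp_add, ofReal_neg, neg_mul, exp_neg (π * I), exp_pi_mul_I, inv_neg_one, mul_neg_one]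
  have hjump : h (x + (-π : ℝ) * I) - h (x + π * I) = 2 * π * I * (stieltjesDensity h x : ℂ) := by
    have hpi : (π : ℂ) ≠ 0 := ofReal_ne_zero.2 Real.pi_ne_zero
    have hw : (x + (-π : ℝ) * I : ℂ) = conj (x + π * I : ℂ) := by simp
    rw [hw, hconj, stieltjesDensity, ← neg_sub, sub_conj]
    push_cast
    field_simp
  rw [expSlope_of_exp_eq_neg htop, expSlope_of_exp_eq_neg hbottom, ← sub_mul,
    sub_sub_sub_cancel_right, hjump, ofReal_mul, mul_assoc]

theorem integral_boundary_expSlope (hh : DifferentiableOn ℂ h logStrip) (u N : ℝ) :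
    (∫ x in (-N)..N, (expSlope h u (x + (-π : ℝ) * I) - expSlope h u (x + π * I))) +
      I * (∫ y in (-π)..π, expSlope h u (N + y * I)) -
      I * (∫ y in (-π)..π, expSlope h u ((-N : ℝ) + y * I)) = 0 := by
  have hd := differentiableOn_expSlope hh u
  have hsub : uIcc (-N) N ×ℂ uIcc (-π) π ⊆ logStrip := fun w hw => by
    rw [uIcc_of_le (by linarith [Real.pi_pos] : -π ≤ π)] at hw
    exact abs_le.2 hw.2
  have hcauchy := integral_boundary_rect_eq_zero_of_differentiableOn (expSlope h u)
    (-N - π * I) (N + π * I) (hd.mono (by simpa using hsub))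
  have hcont (y : ℝ) (hy : |y| ≤ π) : Continuous fun x : ℝ => expSlope h u (x + y * I) :=
    hd.continuousOn.comp_continuous (by fun_prop) fun x => add_mul_I_mem_logStrip hy
  rw [intervalIntegral.integral_sub
    ((hcont _ (by rw [abs_neg, abs_of_pos Real.pi_pos])).intervalIntegrable _ _)
    ((hcont _ (abs_of_pos Real.pi_pos).le).intervalIntegrable _ _)]
  simpa using hcauchy

theorem tendsto_integral_stieltjesDensity (hh : DifferentiableOn ℂ h logStrip)
    (hconj : ∀ w, h (conj w) = conj (h w))
    (htop : Tendsto h (comap re atTop ⊓ 𝓟 logStrip) (𝓝 0))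
    (hbot : Tendsto (fun w => h w * exp w) (comap re atBot ⊓ 𝓟 logStrip) (𝓝 0)) (u : ℝ) :
    Tendsto (fun N : ℝ =>
      ∫ x in (-N)..N, stieltjesDensity h x * (Real.exp x / (Real.exp x + Real.exp u)))
      atTop (𝓝 (h u).re) := by
  have hcont := (differentiableOn_expSlope hh u).continuousOn
  have hright := tendsto_integral_vertical_segment hcont
    (tendsto_expSlope_comap_re_atTop inf_le_left htop u)
  have hleft := (tendsto_integral_vertical_segment hcont
    (tendsto_expSlope_comap_re_atBot inf_le_left hbot u)).comp tendsto_neg_atTop_atBot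
  have hlim := (hleft.sub hright).const_mul (2 * π : ℂ)⁻¹
  rw [mul_zero, zero_sub, ← mul_neg, neg_neg, inv_mul_cancel_left₀ (by simp)] at hlim
  refine ((continuous_re.tendsto _).comp hlim).congr fun N => ?_
  have hcauchy := integral_boundary_expSlope hh u N
  simp only [expSlope_bottom_sub_top hconj, intervalIntegral.integral_const_mul,
    intervalIntegral.integral_ofReal] at hcauchy
  have hval : (2 * π : ℂ)⁻¹ * ((∫ y in (-π)..π, expSlope h u ((-N : ℝ) + y * I)) -
      ∫ y in (-π)..π, expSlope h u (N + y * I)) =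
      ((∫ x in (-N)..N,
        stieltjesDensity h x * (Real.exp x / (Real.exp x + Real.exp u)) : ℝ) : ℂ) := by
    rw [inv_mul_eq_iff_eq_mul₀ (by simp)]
    refine mul_left_cancel₀ I_ne_zero ?_
    linear_combination -hcauchy
  simp only [Function.comp_apply, hval, ofReal_re]

theorem integral_stieltjesDensity (hh : DifferentiableOn ℂ h logStrip)
    (hconj : ∀ w, h (conj w) = conj (h w))
    (htop : Tendsto h (comap re atTop ⊓ 𝓟 logStrip) (𝓝 0))
    (hbot : Tendsto (fun w => h w * exp w) (comap re atBot ⊓ 𝓟 logStrip) (𝓝 0))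
    (hpos : ∀ x, 0 ≤ stieltjesDensity h x) (u : ℝ) :
    Integrable (fun x => stieltjesDensity h x * (Real.exp x / (Real.exp x + Real.exp u))) ∧
      ∫ x, stieltjesDensity h x * (Real.exp x / (Real.exp x + Real.exp u)) = (h u).re := by
  have hlim := tendsto_integral_stieltjesDensity hh hconj htop hbot u
  have hcont : Continuous fun x =>
      stieltjesDensity h x * (Real.exp x / (Real.exp x + Real.exp u)) :=
    (continuous_stieltjesDensity hh.continuousOn).mul
      (Real.continuous_exp.div (by fun_prop) fun x => by positivity)
  have hint : Integrable fun x =>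
      stieltjesDensity h x * (Real.exp x / (Real.exp x + Real.exp u)) := by
    refine integrable_of_intervalIntegral_norm_tendsto (a := fun N : ℝ => -N) (b := id) (h u).re
      (fun N => hcont.integrableOn_Ioc) tendsto_neg_atTop_atBot tendsto_id
      (hlim.congr fun N => intervalIntegral.integral_congr fun x _ => ?_)
    have := hpos x
    exact (Real.norm_of_nonneg (by positivity)).symm
  exact ⟨hint, tendsto_nhds_unique
    (intervalIntegral_tendsto_integral hint tendsto_neg_atTop_atBot tendsto_id) hlim⟩

/-- The measure with `∫ (s + e ^ x)⁻¹ dμ = h (log s)`, i.e. the Stieltjes measure of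
`h ∘ log` in the logarithmic coordinate `x` of the cut. -/
noncomputable def stieltjesMeasure (h : ℂ → ℂ) : Measure ℝ :=
  volume.withDensity fun x => ENNReal.ofReal (stieltjesDensity h x * Real.exp x)

instance : SFinite (stieltjesMeasure h) := by
  unfold stieltjesMeasure
  infer_instance

theorem integral_inv_stieltjesMeasure (hh : DifferentiableOn ℂ h logStrip)
    (hconj : ∀ w, h (conj w) = conj (h w))
    (htop : Tendsto h (comap re atTop ⊓ 𝓟 logStrip) (𝓝 0))
    (hbot : Tendsto (fun w => h w * exp w) (comap re atBot ⊓ 𝓟 logStrip) (𝓝 0))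
    (hpos : ∀ x, 0 ≤ stieltjesDensity h x) {s : ℝ} (hs : 0 < s) :
    Integrable (fun x => (s + Real.exp x)⁻¹) (stieltjesMeasure h) ∧
      ∫ x, (s + Real.exp x)⁻¹ ∂stieltjesMeasure h = (h (Real.log s : ℝ)).re := by
  have hcont : Continuous (stieltjesDensity h) := continuous_stieltjesDensity hh.continuousOn
  have hmeas : Measurable fun x => ENNReal.ofReal (stieltjesDensity h x * Real.exp x) := by
    fun_prop
  have hfin : ∀ᵐ x, ENNReal.ofReal (stieltjesDensity h x * Real.exp x) < ⊤ :=
    ae_of_all _ fun x => ENNReal.ofReal_lt_top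
  have hsmul (x : ℝ) : (ENNReal.ofReal (stieltjesDensity h x * Real.exp x)).toReal •
      (s + Real.exp x)⁻¹ =
      stieltjesDensity h x * (Real.exp x / (Real.exp x + Real.exp (Real.log s))) := by
    rw [ENNReal.toReal_ofReal (mul_nonneg (hpos x) (Real.exp_pos x).le), Real.exp_log hs,
      smul_eq_mul, add_comm, div_eq_mul_inv, mul_assoc]
  rw [stieltjesMeasure, integrable_withDensity_iff_integrable_smul' hmeas hfin,
    integral_withDensity_eq_integral_toReal_smul hmeas hfin]
  simp only [hsmul]
  exact integral_stieltjesDensity hh hconj htop hbot hpos (Real.log s)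

end Stieltjes

section Symbol

open Complex
open scoped ComplexConjugate Real

variable {m : ℕ} {α : ℝ} {a b : Fin m → ℝ} {lam : ℝ}

/-- The symbol `z ^ α + λ + ∑ b_i z ^ α_i` of the fractional operator in the coordinate
`w = log z`; its inverse is the Laplace transform of the kernel. -/
noncomputable def logSymbol (α : ℝ) (a b : Fin m → ℝ) (lam : ℝ) (w : ℂ) : ℂ :=
  exp (α * w) + lam + ∑ i, b i * exp (a i * w)

theorem differentiable_logSymbol : Differentiable ℂ (logSymbol α a b lam) := by
  unfold logSymbol
  fun_prop

theorem logSymbol_conj (w : ℂ) :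
    logSymbol α a b lam (conj w) = conj (logSymbol α a b lam w) := by
  simp [logSymbol, ← exp_conj]

theorem logSymbol_log {s : ℝ} (hs : 0 < s) :
    logSymbol α a b lam (Real.log s) = ((s ^ α + lam + ∑ i, b i * s ^ a i : ℝ) : ℂ) := by
  simp only [logSymbol, Real.rpow_def_of_pos hs, mul_comm (Real.log s)]
  push_cast
  rfl

theorem exp_ofReal_mul_im_pos {c : ℝ} (hc₀ : 0 < c) (hc₁ : c < 1) {w : ℂ} (hw₀ : 0 < w.im)
    (hw₁ : w.im ≤ π) : 0 < (exp (c * w)).im := by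
  rw [exp_im, re_ofReal_mul, im_ofReal_mul]
  exact mul_pos (Real.exp_pos _) (Real.sin_pos_of_pos_of_lt_pi (by positivity) (by nlinarith))

theorem logSymbol_im_pos (hα₀ : 0 < α) (hα₁ : α < 1) (ha₀ : ∀ i, 0 < a i) (ha₁ : ∀ i, a i < α)
    (hb : ∀ i, 0 ≤ b i) {w : ℂ} (hw₀ : 0 < w.im) (hw₁ : w.im ≤ π) :
    0 < (logSymbol α a b lam w).im := by
  simp only [logSymbol, add_im, ofReal_im, im_sum, im_ofReal_mul, add_zero]
  exact add_pos_of_pos_of_nonneg (exp_ofReal_mul_im_pos hα₀ hα₁ hw₀ hw₁) <|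
    Finset.sum_nonneg fun i _ => mul_nonneg (hb i)
      (exp_ofReal_mul_im_pos (ha₀ i) ((ha₁ i).trans hα₁) hw₀ hw₁).le

theorem logSymbol_ne_zero (hα₀ : 0 < α) (hα₁ : α < 1) (ha₀ : ∀ i, 0 < a i) (ha₁ : ∀ i, a i < α)
    (hb : ∀ i, 0 ≤ b i) (hlam : 0 ≤ lam) {w : ℂ} (hw : w ∈ logStrip) :
    logSymbol α a b lam w ≠ 0 := by
  obtain ⟨hw_ge, hw_le⟩ := abs_le.1 (show |w.im| ≤ π from hw)
  have him {v : ℂ} (hv₀ : 0 < v.im) (hv₁ : v.im ≤ π) : logSymbol α a b lam v ≠ 0 := fun h0 =>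
    (logSymbol_im_pos hα₀ hα₁ ha₀ ha₁ hb hv₀ hv₁).ne' (by rw [h0, zero_im])
  rcases lt_trichotomy w.im 0 with hneg | hreal | hpos
  · have hconj := him (v := conj w) (by simpa using hneg) (by rw [conj_im]; linarith)
    rwa [logSymbol_conj, map_ne_zero] at hconj
  · lift w to ℝ using hreal
    rw [← Real.log_exp w, logSymbol_log (Real.exp_pos w), ofReal_ne_zero]
    have hsum : 0 ≤ ∑ i, b i * Real.exp w ^ a i :=
      Finset.sum_nonneg fun i _ => mul_nonneg (hb i) (by positivity)
    positivity
  · exact him hpos hw_le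

theorem tendsto_exp_ofReal_mul {l : Filter ℂ} {c : ℝ} (h : Tendsto (fun w => c * re w) l atBot) :
    Tendsto (fun w => exp (c * w)) l (𝓝 0) :=
  tendsto_exp_comap_re_atBot.comp
    (tendsto_comap_iff.2 (h.congr fun w => (re_ofReal_mul c w).symm))

theorem tendsto_inv_logSymbol_comap_re_atTop (hα₀ : 0 < α) (ha₁ : ∀ i, a i < α) :
    Tendsto (logSymbol α a b lam)⁻¹ (comap re atTop) (𝓝 0) := by
  have hexp {c : ℝ} (hc : c < 0) : Tendsto (fun w => exp (c * w)) (comap re atTop) (𝓝 0) :=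
    tendsto_exp_ofReal_mul (tendsto_comap.const_mul_atTop_of_neg hc)
  have hα := hexp (neg_lt_zero.2 hα₀)
  have hratio : Tendsto (fun w => 1 + lam * exp ((-α : ℝ) * w) +
      ∑ i, b i * exp ((a i - α : ℝ) * w)) (comap re atTop) (𝓝 1) := by
    simpa using (hα.const_mul (lam : ℂ)).const_add 1 |>.add <| tendsto_finsetSum Finset.univ
      fun i _ => (hexp (sub_neg.2 (ha₁ i))).const_mul (b i : ℂ)
  refine (zero_mul (1⁻¹ : ℂ) ▸ hα.mul (hratio.inv₀ one_ne_zero)).congr fun w => ?_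
  have hfactor : logSymbol α a b lam w = exp (α * w) * (1 + lam * exp ((-α : ℝ) * w) +
      ∑ i, b i * exp ((a i - α : ℝ) * w)) := by
    simp only [logSymbol, mul_add, mul_one, mul_left_comm (exp (α * w)), ← exp_add,
      Finset.mul_sum, ← add_mul, ← ofReal_add, add_neg_cancel, add_sub_cancel, ofReal_zero,
      zero_mul, exp_zero]
  rw [Pi.inv_apply, hfactor, mul_inv, ← exp_neg, ofReal_neg, neg_mul]

theorem tendsto_logSymbol_comap_re_atBot (hα₀ : 0 < α) (ha₀ : ∀ i, 0 < a i) :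
    Tendsto (logSymbol α a b lam) (comap re atBot) (𝓝 lam) := by
  have hexp {c : ℝ} (hc : 0 < c) : Tendsto (fun w => exp (c * w)) (comap re atBot) (𝓝 0) :=
    tendsto_exp_ofReal_mul (tendsto_comap.const_mul_atBot hc)
  unfold logSymbol
  simpa using ((hexp hα₀).add_const (lam : ℂ)).add <| tendsto_finsetSum Finset.univ
    fun i _ => (hexp (ha₀ i)).const_mul (b i : ℂ)

theorem stieltjesDensity_inv_nonneg {h : ℂ → ℂ} {x : ℝ} (hx : 0 ≤ (h (x + π * I)).im) :
    0 ≤ stieltjesDensity h⁻¹ x := by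
  simp only [stieltjesDensity, Pi.inv_apply, inv_im, neg_div, neg_neg]
  have := normSq_nonneg (h (x + π * I))
  positivity

/-- The measure of which the kernel is the Laplace transform, in the logarithmic coordinate
`x = log r` of the spectral parameter `r`. -/
noncomputable def spectralMeasure (α : ℝ) (a b : Fin m → ℝ) (lam : ℝ) : Measure ℝ :=
  stieltjesMeasure (logSymbol α a b lam)⁻¹

instance : SFinite (spectralMeasure α a b lam) := by
  unfold spectralMeasure
  infer_instance

theorem integral_inv_spectralMeasure (hα₀ : 0 < α) (hα₁ : α < 1) (ha₀ : ∀ i, 0 < a i)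
    (ha₁ : ∀ i, a i < α) (hb : ∀ i, 0 ≤ b i) (hlam : 0 < lam) {s : ℝ} (hs : 0 < s) :
    Integrable (fun x => (s + Real.exp x)⁻¹) (spectralMeasure α a b lam) ∧
      ∫ x, (s + Real.exp x)⁻¹ ∂spectralMeasure α a b lam =
        (s ^ α + lam + ∑ i, b i * s ^ a i)⁻¹ := by
  have hval : ((logSymbol α a b lam)⁻¹ (Real.log s : ℝ)).re =
      (s ^ α + lam + ∑ i, b i * s ^ a i)⁻¹ := by
    rw [Pi.inv_apply, logSymbol_log hs, ← ofReal_inv, ofReal_re]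
  rw [← hval]
  refine integral_inv_stieltjesMeasure
    (differentiable_logSymbol.differentiableOn.inv fun w hw =>
      logSymbol_ne_zero hα₀ hα₁ ha₀ ha₁ hb hlam.le hw)
    (fun w => by rw [Pi.inv_apply, logSymbol_conj, Pi.inv_apply, map_inv₀])
    ((tendsto_inv_logSymbol_comap_re_atTop hα₀ ha₁).mono_left inf_le_left) ?_
    (fun x => stieltjesDensity_inv_nonneg (logSymbol_im_pos hα₀ hα₁ ha₀ ha₁ hb
      (by simpa using Real.pi_pos) (by simp)).le) hs
  have hexp : Tendsto exp (comap re atBot) (𝓝 0) := tendsto_exp_comap_re_atBot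
  simpa using (((tendsto_logSymbol_comap_re_atBot hα₀ ha₀).inv₀
    (ofReal_ne_zero.2 hlam.ne')).mul hexp).mono_left inf_le_left

end Symbol

section MittagLeffler

variable {n : ℕ} {β : Fin n → ℝ} {β₀ s : ℝ}

theorem inv_Gamma_le {x R : ℝ} (hx : 0 < x) (hR : 0 < R) :
    (Real.Gamma x)⁻¹ ≤ Real.exp (Real.exp 1 * R) * R ^ (-x) := by
  have hlower : Real.exp (-(Real.exp 1 * R)) / x ≤
      Real.Gamma x * (Real.exp 1 * R) ^ (-x) := by
    have h := (hasLaplace_rpow_sub_one hx (s := Real.exp 1 * R)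
      (by positivity)).exp_mul_setIntegral_Ioc_le (by positivity)
      (fun t ht => Real.rpow_nonneg ht.le _) 1
    rwa [← intervalIntegral.integral_of_le zero_le_one, integral_rpow (Or.inl (by linarith)),
      sub_add_cancel, Real.one_rpow, Real.zero_rpow hx.ne', sub_zero, mul_one, mul_one_div] at h
  have hΓ := Real.Gamma_pos_of_pos hx
  have hx_le : x ≤ Real.exp 1 ^ x := by
    rw [Real.exp_one_rpow]
    linarith [Real.add_one_le_exp x]
  rw [Real.exp_neg, ← one_div, div_div, div_le_iff₀ (by positivity)] at hlower
  rw [inv_le_iff_one_le_mul₀ hΓ]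
  calc 1 ≤ Real.Gamma x * (Real.exp 1 * R) ^ (-x) * (Real.exp (Real.exp 1 * R) * x) := hlower
    _ ≤ Real.Gamma x * (Real.exp 1 * R) ^ (-x) *
        (Real.exp (Real.exp 1 * R) * Real.exp 1 ^ x) := by gcongr
    _ = Real.exp (Real.exp 1 * R) * R ^ (-x) * Real.Gamma x := by
      rw [Real.mul_rpow (by positivity) hR.le, Real.rpow_neg (Real.exp_pos 1).le]
      field_simp

theorem add_sum_mul_pos (hβ : ∀ i, 0 ≤ β i) (hβ₀ : 0 < β₀) (l : Fin n → ℕ) :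
    0 < β₀ + ∑ i, β i * (l i : ℝ) :=
  add_pos_of_pos_of_nonneg hβ₀
    (Finset.sum_nonneg fun i _ => mul_nonneg (hβ i) (Nat.cast_nonneg _))

theorem prod_mul_rpow_pow {t : ℝ} (ht : 0 < t) (c β : Fin n → ℝ) (l : Fin n → ℕ) :
    ∏ i, (c i * t ^ β i) ^ l i = (∏ i, c i ^ l i) * t ^ (∑ i, β i * (l i : ℝ)) := by
  simp only [mul_pow, ← Real.rpow_mul_natCast ht.le, Finset.prod_mul_distrib,
    Real.rpow_sum_of_pos ht]

theorem rpow_mul_sum_pow {t : ℝ} (ht : 0 < t) (r : ℝ) (c β : Fin n → ℝ) (k : ℕ) :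
    t ^ r * (∑ i, c i * t ^ β i) ^ k =
      ∑ l ∈ Finset.piAntidiag Finset.univ k, (Nat.multinomial Finset.univ l : ℝ) *
        (∏ i, c i ^ l i) * t ^ (r + ∑ i, β i * (l i : ℝ)) := by
  rw [Finset.sum_pow_eq_sum_piAntidiag, Finset.mul_sum]
  refine Finset.sum_congr rfl fun l _ => ?_
  rw [prod_mul_rpow_pow ht, Real.rpow_add ht]
  ring

theorem norm_multinomialMLTerm_le {𝕜 : Type*} [RCLike 𝕜] (hβ : ∀ i, 0 ≤ β i) (hβ₀ : 0 < β₀)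
    (z : Fin n → 𝕜) (k : ℕ) :
    ‖multinomialMLTerm β β₀ z k‖ ≤ multinomialMLTerm β β₀ (fun i => ‖z i‖) k := by
  refine norm_sum_le_of_le _ fun l _ => le_of_eq ?_
  have hΓ := Real.Gamma_pos_of_pos (add_sum_mul_pos hβ hβ₀ l)
  simp [abs_of_pos hΓ]

theorem multinomialMLTerm_le_mul_pow (hβ : ∀ i, 0 ≤ β i) (hβ₀ : 0 < β₀) {x : Fin n → ℝ}
    (hx : ∀ i, 0 ≤ x i) {R : ℝ} (hR : 0 < R) (k : ℕ) :
    multinomialMLTerm β β₀ x k ≤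
      Real.exp (Real.exp 1 * R) * (R ^ (-β₀) * (∑ i, x i * R ^ (-β i)) ^ k) := by
  rw [rpow_mul_sum_pow hR, Finset.mul_sum]
  refine Finset.sum_le_sum fun l _ => ?_
  have hprod : 0 ≤ ∏ i, x i ^ l i := Finset.prod_nonneg fun i _ => pow_nonneg (hx i) _
  calc (Nat.multinomial Finset.univ l : ℝ) *
        ((∏ i, x i ^ l i) / Real.Gamma (β₀ + ∑ i, β i * (l i : ℝ)))
      ≤ (Nat.multinomial Finset.univ l : ℝ) * ((∏ i, x i ^ l i) *
        (Real.exp (Real.exp 1 * R) * R ^ (-(β₀ + ∑ i, β i * (l i : ℝ))))) := by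
        rw [div_eq_mul_inv]
        gcongr
        exact inv_Gamma_le (add_sum_mul_pos hβ hβ₀ l) hR
    _ = _ := by
        simp only [neg_add, ← Finset.sum_neg_distrib, neg_mul]
        ring

theorem eventually_sum_mul_rpow_neg_lt_one (hβ : ∀ i, 0 < β i) (c : Fin n → ℝ) :
    ∀ᶠ s : ℝ in atTop, ∑ i, c i * s ^ (-β i) < 1 := by
  have hlim : Tendsto (fun s : ℝ => ∑ i, c i * s ^ (-β i)) atTop (𝓝 0) := by
    simpa using tendsto_finsetSum Finset.univ
      fun i _ => (tendsto_rpow_neg_atTop (hβ i)).const_mul (c i)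
  exact hlim.eventually_lt_const one_pos

theorem exists_summable_forall_norm_multinomialMLTerm_le (𝕜 : Type*) [RCLike 𝕜]
    (hβ : ∀ i, 0 < β i) (hβ₀ : 0 < β₀) {r : Fin n → ℝ} (hr : ∀ i, 0 ≤ r i) :
    ∃ u : ℕ → ℝ, Summable u ∧
      ∀ (k : ℕ) (z : Fin n → 𝕜), (∀ i, ‖z i‖ ≤ r i) → ‖multinomialMLTerm β β₀ z k‖ ≤ u k := by
  obtain ⟨R, hlt, hR⟩ :=
    ((eventually_sum_mul_rpow_neg_lt_one hβ r).and (eventually_gt_atTop 0)).exists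
  have hratio : 0 ≤ ∑ i, r i * R ^ (-β i) :=
    Finset.sum_nonneg fun i _ => mul_nonneg (hr i) (by positivity)
  refine ⟨fun k => Real.exp (Real.exp 1 * R) * (R ^ (-β₀) * (∑ i, r i * R ^ (-β i)) ^ k),
    ((summable_geometric_of_lt_one hratio hlt).mul_left _).mul_left _, fun k z hz => ?_⟩
  have hβ' (i : Fin n) := (hβ i).le
  calc ‖multinomialMLTerm β β₀ z k‖ ≤ multinomialMLTerm β β₀ (fun i => ‖z i‖) k :=
        norm_multinomialMLTerm_le hβ' hβ₀ z k
    _ ≤ Real.exp (Real.exp 1 * R) * (R ^ (-β₀) * (∑ i, ‖z i‖ * R ^ (-β i)) ^ k) :=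
        multinomialMLTerm_le_mul_pow hβ' hβ₀ (fun i => norm_nonneg _) hR k
    _ ≤ Real.exp (Real.exp 1 * R) * (R ^ (-β₀) * (∑ i, r i * R ^ (-β i)) ^ k) := by
        gcongr with i
        exact hz i

theorem summable_multinomialMLTerm {𝕜 : Type*} [RCLike 𝕜] (hβ : ∀ i, 0 < β i) (hβ₀ : 0 < β₀)
    (z : Fin n → 𝕜) : Summable (multinomialMLTerm β β₀ z) := by
  obtain ⟨u, hu, hle⟩ := exists_summable_forall_norm_multinomialMLTerm_le 𝕜 hβ hβ₀
    fun i => norm_nonneg (z i)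
  exact hu.of_norm_bounded fun k => hle k z fun i => le_rfl

theorem hasSum_multinomialMLTerm {𝕜 : Type*} [RCLike 𝕜] (hβ : ∀ i, 0 < β i) (hβ₀ : 0 < β₀)
    (z : Fin n → 𝕜) : HasSum (multinomialMLTerm β β₀ z) (multinomialML β β₀ z) :=
  (summable_multinomialMLTerm hβ hβ₀ z).hasSum

theorem continuous_multinomialML {𝕜 : Type*} [RCLike 𝕜] (hβ : ∀ i, 0 < β i) (hβ₀ : 0 < β₀) :
    Continuous (multinomialML β β₀ : (Fin n → 𝕜) → 𝕜) := by
  refine continuous_iff_continuousAt.2 fun z => ?_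
  obtain ⟨u, hu, hle⟩ := exists_summable_forall_norm_multinomialMLTerm_le 𝕜 hβ hβ₀
    (r := fun _ => ‖z‖ + 1) fun _ => by positivity
  have hball : ContinuousOn (multinomialML β β₀) (Metric.ball z 1) :=
    continuousOn_tsum (fun k => by unfold multinomialMLTerm; fun_prop) hu fun k w hw =>
      hle k w fun i => (norm_le_pi_norm w i).trans <| by
        linarith [norm_le_norm_add_norm_sub' w z, mem_ball_iff_norm.1 hw]
  exact hball.continuousAt (Metric.ball_mem_nhds z one_pos)

theorem rpow_mul_multinomialMLTerm {t : ℝ} (ht : 0 < t) (c : Fin n → ℝ) (k : ℕ) :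
    t ^ (β₀ - 1) * multinomialMLTerm β β₀ (fun i => c i * t ^ β i) k =
      ∑ l ∈ Finset.piAntidiag Finset.univ k, (Nat.multinomial Finset.univ l : ℝ) *
        (∏ i, c i ^ l i) / Real.Gamma (β₀ + ∑ i, β i * (l i : ℝ)) *
          t ^ (β₀ + ∑ i, β i * (l i : ℝ) - 1) := by
  simp only [multinomialMLTerm, Finset.mul_sum, RCLike.ofReal_real_eq_id, id]
  refine Finset.sum_congr rfl fun l _ => ?_
  rw [prod_mul_rpow_pow ht, add_sub_right_comm, Real.rpow_add ht]
  ring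

theorem hasLaplace_rpow_mul_multinomialMLTerm (hβ : ∀ i, 0 ≤ β i) (hβ₀ : 0 < β₀)
    (c : Fin n → ℝ) (hs : 0 < s) (k : ℕ) :
    HasLaplace (fun t => t ^ (β₀ - 1) * multinomialMLTerm β β₀ (fun i => c i * t ^ β i) k) s
      (s ^ (-β₀) * (∑ i, c i * s ^ (-β i)) ^ k) := by
  have hsum := HasLaplace.sum (S := Finset.piAntidiag Finset.univ k) fun l _ =>
    (hasLaplace_rpow_sub_one (add_sum_mul_pos hβ hβ₀ l) hs).const_mul
      ((Nat.multinomial Finset.univ l : ℝ) * (∏ i, c i ^ l i) /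
        Real.Gamma (β₀ + ∑ i, β i * (l i : ℝ)))
  have hval : s ^ (-β₀) * (∑ i, c i * s ^ (-β i)) ^ k =
      ∑ l ∈ Finset.piAntidiag Finset.univ k, (Nat.multinomial Finset.univ l : ℝ) *
        (∏ i, c i ^ l i) / Real.Gamma (β₀ + ∑ i, β i * (l i : ℝ)) *
          (Real.Gamma (β₀ + ∑ i, β i * (l i : ℝ)) * s ^ (-(β₀ + ∑ i, β i * (l i : ℝ)))) := by
    rw [rpow_mul_sum_pow hs]
    refine Finset.sum_congr rfl fun l _ => ?_
    have hΓ := (Real.Gamma_pos_of_pos (add_sum_mul_pos hβ hβ₀ l)).ne'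
    simp only [neg_add, ← Finset.sum_neg_distrib, neg_mul]
    field_simp
  rw [hval]
  exact hsum.congr fun t ht => (rpow_mul_multinomialMLTerm ht c k).symm

theorem hasLaplace_rpow_mul_multinomialML (hβ : ∀ i, 0 < β i) (hβ₀ : 0 < β₀) {c : Fin n → ℝ}
    (hs : 0 < s) (hc : ∑ i, |c i| * s ^ (-β i) < 1) :
    HasLaplace (fun t => t ^ (β₀ - 1) * multinomialML β β₀ (fun i => c i * t ^ β i)) s
      (s ^ (-β₀) * (1 - ∑ i, c i * s ^ (-β i))⁻¹) := by
  have hβ' (i : Fin n) := (hβ i).le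
  have hratio : ‖∑ i, c i * s ^ (-β i)‖ ≤ ∑ i, |c i| * s ^ (-β i) :=
    norm_sum_le_of_le _ fun i _ => by simp [abs_of_pos (Real.rpow_pos_of_pos hs _)]
  rw [← tsum_geometric_of_norm_lt_one (hratio.trans_lt hc), ← tsum_mul_left]
  have hsum (t : ℝ) : HasSum
      (fun k => t ^ (β₀ - 1) * multinomialMLTerm β β₀ (fun i => c i * t ^ β i) k)
      (t ^ (β₀ - 1) * multinomialML β β₀ (fun i => c i * t ^ β i)) :=
    (hasSum_multinomialMLTerm hβ hβ₀ fun i => c i * t ^ β i).mul_left (t ^ (β₀ - 1))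
  have hmajorant (k : ℕ) (t : ℝ) (ht : 0 < t) :
      ‖t ^ (β₀ - 1) * multinomialMLTerm β β₀ (fun i => c i * t ^ β i) k‖ ≤
        t ^ (β₀ - 1) * multinomialMLTerm β β₀ (fun i => |c i| * t ^ β i) k := by
    rw [norm_mul, Real.norm_of_nonneg (Real.rpow_nonneg ht.le _)]
    gcongr
    simpa [abs_of_pos (Real.rpow_pos_of_pos ht _)] using
      norm_multinomialMLTerm_le hβ' hβ₀ (fun i => c i * t ^ β i) k
  exact HasLaplace.hasSum_of_norm_le (hasLaplace_rpow_mul_multinomialMLTerm hβ' hβ₀ c hs)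
    (hasLaplace_rpow_mul_multinomialMLTerm hβ' hβ₀ (fun i => |c i|) hs) hmajorant
    ((summable_geometric_of_lt_one ((norm_nonneg _).trans hratio) hc).mul_left _)
    fun t _ => hsum t

end MittagLeffler

section Kernel

variable {m : ℕ} {α : ℝ} {a b : Fin m → ℝ} {lam : ℝ}

theorem kernelOrders_pos (hα₀ : 0 < α) (ha₁ : ∀ i, a i < α) (i : Fin (m + 1)) :
    0 < kernelOrders α a i := by
  refine Fin.cases hα₀ (fun j => ?_) i
  simpa [kernelOrders] using ha₁ j

/-- The coefficients `(-λ, -b_1, ..., -b_m)` of the powers of `t` in `kernelArgs`. -/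
noncomputable def kernelCoeffs (b : Fin m → ℝ) (lam : ℝ) : Fin (m + 1) → ℝ :=
  Matrix.vecCons (-lam) (-b)

theorem kernelArgs_eq (t : ℝ) :
    kernelArgs α a b lam t = fun i => kernelCoeffs b lam i * t ^ kernelOrders α a i := by
  funext i
  refine Fin.cases ?_ (fun j => ?_) i <;> simp [kernelArgs, kernelCoeffs, kernelOrders]

theorem continuousOn_scalarKernel (hα₀ : 0 < α) (ha₁ : ∀ i, a i < α) :
    ContinuousOn (scalarKernel α a b lam) (Ioi 0) := by
  have hrpow (r : ℝ) : ContinuousOn (fun t : ℝ => t ^ r) (Ioi 0) :=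
    continuousOn_id.rpow_const fun t ht => Or.inl (ne_of_gt ht)
  unfold scalarKernel
  simp only [kernelArgs_eq]
  exact (hrpow _).mul <|
    (continuous_multinomialML (kernelOrders_pos hα₀ ha₁) hα₀).comp_continuousOn <|
      continuousOn_pi.2 fun i => continuousOn_const.mul (hrpow _)

theorem rpow_mul_one_sub_sum_kernelCoeffs {s : ℝ} (hs : 0 < s) :
    s ^ α * (1 - ∑ i, kernelCoeffs b lam i * s ^ (-kernelOrders α a i)) =
      s ^ α + lam + ∑ i, b i * s ^ a i := by
  have hα : s ^ α * s ^ (-α) = 1 := by rw [← Real.rpow_add hs, add_neg_cancel, Real.rpow_zero]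
  have ha (i : Fin m) : s ^ α * s ^ (-(α - a i)) = s ^ a i := by
    rw [← Real.rpow_add hs, neg_sub, add_sub_cancel]
  simp only [kernelCoeffs, kernelOrders, Fin.sum_univ_succ, Matrix.cons_val_zero,
    Matrix.cons_val_succ, Pi.neg_apply, neg_mul, Finset.sum_neg_distrib, ← ha,
    mul_left_comm _ (s ^ α), ← Finset.mul_sum]
  linear_combination lam * hα

theorem eventually_hasLaplace_scalarKernel (hα₀ : 0 < α) (ha₁ : ∀ i, a i < α) :
    ∀ᶠ s in atTop,
      HasLaplace (scalarKernel α a b lam) s (s ^ α + lam + ∑ i, b i * s ^ a i)⁻¹ := by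
  have hβ := kernelOrders_pos hα₀ ha₁
  filter_upwards [eventually_gt_atTop 0, eventually_sum_mul_rpow_neg_lt_one hβ
    fun i => |kernelCoeffs b lam i|] with s hs hlt
  unfold scalarKernel
  simp only [kernelArgs_eq, ← rpow_mul_one_sub_sum_kernelCoeffs hs, mul_inv, ← Real.rpow_neg hs.le]
  exact hasLaplace_rpow_mul_multinomialML hβ hα₀ hs hlt

theorem inv_rpow_add_sum_le_one_div (hb : ∀ i, 0 ≤ b i) (hlam : 0 < lam) {s : ℝ} (hs : 0 < s) :
    (s ^ α + lam + ∑ i, b i * s ^ a i)⁻¹ ≤ 1 / lam := by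
  rw [one_div]
  refine inv_anti₀ hlam ?_
  have hsum : 0 ≤ ∑ i, b i * s ^ a i :=
    Finset.sum_nonneg fun i _ => mul_nonneg (hb i) (by positivity)
  linarith [Real.rpow_pos_of_pos hs α]

variable (hα₀ : 0 < α) (hα₁ : α < 1) (ha₀ : ∀ i, 0 < a i) (ha₁ : ∀ i, a i < α)
  (hb : ∀ i, 0 ≤ b i) (hlam : 0 < lam)

include hα₀ hα₁ ha₀ ha₁ hb hlam

theorem integrable_inv_sub_spectralMeasure {s : ℝ} (hs : 0 < s) :
    Integrable (fun x => (s - -Real.exp x)⁻¹) (spectralMeasure α a b lam) := by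
  simpa only [sub_neg_eq_add] using
    (integral_inv_spectralMeasure hα₀ hα₁ ha₀ ha₁ hb hlam hs).1

theorem hasLaplace_mgf_spectralMeasure {s : ℝ} (hs : 0 < s) :
    HasLaplace (mgf (fun x => -Real.exp x) (spectralMeasure α a b lam)) s
      (s ^ α + lam + ∑ i, b i * s ^ a i)⁻¹ := by
  have h := hasLaplace_mgf (by fun_prop) (fun x => neg_nonpos.2 (Real.exp_pos x).le) hs
    (integrable_inv_sub_spectralMeasure hα₀ hα₁ ha₀ ha₁ hb hlam hs)
  simpa only [sub_neg_eq_add, (integral_inv_spectralMeasure hα₀ hα₁ ha₀ ha₁ hb hlam hs).2] using h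

theorem spectralMeasure_ne_zero : spectralMeasure α a b lam ≠ 0 := by
  intro h0
  have hval := (integral_inv_spectralMeasure hα₀ hα₁ ha₀ ha₁ hb hlam one_pos).2
  have hsum : 0 ≤ ∑ i, b i * (1 : ℝ) ^ a i :=
    Finset.sum_nonneg fun i _ => mul_nonneg (hb i) (by positivity)
  rw [h0, integral_zero_measure] at hval
  exact (by positivity : (0 : ℝ) < ((1 : ℝ) ^ α + lam + ∑ i, b i * (1 : ℝ) ^ a i)⁻¹).ne hval

theorem Ioi_subset_interior_integrableExpSet_spectralMeasure :
    Ioi 0 ⊆ interior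
      (integrableExpSet (fun x => -Real.exp x) (spectralMeasure α a b lam)) :=
  Ioi_subset_interior_integrableExpSet (by fun_prop)
    (fun x => neg_nonpos.2 (Real.exp_pos x).le) one_pos
    (integrable_inv_sub_spectralMeasure hα₀ hα₁ ha₀ ha₁ hb hlam one_pos)

theorem scalarKernel_eqOn_mgf :
    EqOn (scalarKernel α a b lam)
      (mgf (fun x => -Real.exp x) (spectralMeasure α a b lam)) (Ioi 0) :=
  HasLaplace.eqOn_of_eventually (continuousOn_scalarKernel hα₀ ha₁)
    (continuousOn_mgf.mono
      (Ioi_subset_interior_integrableExpSet_spectralMeasure hα₀ hα₁ ha₀ ha₁ hb hlam))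
    (eventually_hasLaplace_scalarKernel hα₀ ha₁)
    ((eventually_gt_atTop 0).mono fun _ hs =>
      hasLaplace_mgf_spectralMeasure hα₀ hα₁ ha₀ ha₁ hb hlam hs)

theorem hasLaplace_scalarKernel {s : ℝ} (hs : 0 < s) :
    HasLaplace (scalarKernel α a b lam) s (s ^ α + lam + ∑ i, b i * s ^ a i)⁻¹ :=
  (hasLaplace_mgf_spectralMeasure hα₀ hα₁ ha₀ ha₁ hb hlam hs).congr
    (scalarKernel_eqOn_mgf hα₀ hα₁ ha₀ ha₁ hb hlam).symm

theorem isCompletelyMonotone_scalarKernel :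
    IsCompletelyMonotone (scalarKernel α a b lam) :=
  (isCompletelyMonotone_mgf (fun x => neg_nonpos.2 (Real.exp_pos x).le)
    (Ioi_subset_interior_integrableExpSet_spectralMeasure hα₀ hα₁ ha₀ ha₁ hb hlam)).congr
    (scalarKernel_eqOn_mgf hα₀ hα₁ ha₀ ha₁ hb hlam).symm

theorem scalarKernel_pos {t : ℝ} (ht : 0 < t) : 0 < scalarKernel α a b lam t := by
  have hexp : t ∈ integrableExpSet (fun x => -Real.exp x) (spectralMeasure α a b lam) :=
    interior_subset
      (Ioi_subset_interior_integrableExpSet_spectralMeasure hα₀ hα₁ ha₀ ha₁ hb hlam ht)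
  rw [scalarKernel_eqOn_mgf hα₀ hα₁ ha₀ ha₁ hb hlam ht]
  exact mgf_pos' (spectralMeasure_ne_zero hα₀ hα₁ ha₀ ha₁ hb hlam) hexp

end Kernel

/- The first conjunct says that the series defining the kernel converges, so that the kernel is
the sum of its series and not a default value. -/
theorem lemma2p2 {m : ℕ} (α : ℝ) (hα₀ : 0 < α) (hα₁ : α < 1)
    (a : Fin m → ℝ) (ha₀ : ∀ i, 0 < a i) (ha₁ : ∀ i, a i < α)
    (b : Fin m → ℝ) (hb : ∀ i, 0 < b i) (lam : ℝ) (hlam : 0 < lam) :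
    (∀ t : ℝ, 0 < t →
      Summable (multinomialMLTerm (kernelOrders α a) α (kernelArgs α a b lam t))) ∧
    IsCompletelyMonotone (scalarKernel α a b lam) ∧
    ∀ T : ℝ, 0 < T →
      IntervalIntegrable (scalarKernel α a b lam) MeasureTheory.volume 0 T ∧
      (∫ t in (0 : ℝ)..T, |scalarKernel α a b lam t|) < 1 / lam := by
  have hb₀ (i : Fin m) := (hb i).le
  have hpos {t : ℝ} (ht : 0 < t) : 0 < scalarKernel α a b lam t :=
    scalarKernel_pos hα₀ hα₁ ha₀ ha₁ hb₀ hlam ht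
  have hlaplace {s : ℝ} (hs : 0 < s) :
      HasLaplace (scalarKernel α a b lam) s (s ^ α + lam + ∑ i, b i * s ^ a i)⁻¹ :=
    hasLaplace_scalarKernel hα₀ hα₁ ha₀ ha₁ hb₀ hlam hs
  refine ⟨fun t _ => summable_multinomialMLTerm (kernelOrders_pos hα₀ ha₁) hα₀ _,
    isCompletelyMonotone_scalarKernel hα₀ hα₁ ha₀ ha₁ hb₀ hlam,
    fun T hT => ⟨(hlaplace one_pos).intervalIntegrable le_rfl hT.le, ?_⟩⟩
  have habs : ∫ t in (0 : ℝ)..T, |scalarKernel α a b lam t| =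
      ∫ t in (0 : ℝ)..T, scalarKernel α a b lam t :=
    intervalIntegral.integral_congr_ae (ae_of_all _ fun t ht =>
      abs_of_pos (hpos (uIoc_of_le hT.le ▸ ht).1))
  rw [habs]
  exact integral_lt_of_hasLaplace_le (fun s => hlaplace)
    (fun s => inv_rpow_add_sum_le_one_div hb₀ hlam) (fun t => hpos) hT.le
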